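/- Conventions. For positive integers $\ell, m$, an array code over $\mathbb F_q$ is an $\mathbb F_q$-subspace $\mathcal C\subseteq\mathbb F_q^{\ell\times m}$; its $m$ columns are called nodes, and $\ell$ is its subpacketization. It is an $[m,k,\delta;\ell]$ code if $\dim_{\mathbb F_q}\mathcal C=k\ell$ and the minimum number of nonzero columns of a nonzero codeword is $\delta$ ($\delta$ may be omitted); it is MDS if $\delta=m-k+1$. $\mathcal C|_W$ denotes the restriction to the columns in $W$. For disjoint sets $A,R$ of nodes, let $M(\mathcal C,A,R)$ be the smallest total number of symbols of $\mathbb F_q$ that must be downloaded from the nodes in $R$ (each sending an arbitrary function of its own content) in order to recover the contents of the nodes in $A$. An $[m,m-r;\ell]$ MDS array code is $d$-MSR if $$\max_{|A|=1,\ |R|=d,\ A\cap R=\emptyset} M(\mathcal C,A,R)=\frac{d\,\ell}{1+d-m+r}.$$ An array code $\mathcal C\subseteq\mathbb F_q^{\ell\times\mu n}$ is an $\mathsf{SD}(\mu n,\mu,n,r,s;\ell)$ (sector-disk) code, where $r\le n$ and $s\le(n-r)\mu$, if it is a $[\mu n,(n-r)\mu-s;\ell]$ code and its nodes can be labelled $(j,i)$,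 $j\in[\mu]$, $i\in[n]$, such that, with $W_j=\{(j,i):i\in[n]\}$, every $\mathcal C|_{W_j}$ is an $[n,n-r,r+1;\ell]$ MDS code, and for every $E\subseteq[n]$ with $|E|=r$ the restriction of $\mathcal C$ to $\{(j,i): j\in[\mu],\ i\notin E\}$ is a $[(n-r)\mu,(n-r)\mu-s,s+1;\ell]$ MDS code. It is locally $d$-MSR if moreover (for the same labelling) every $\mathcal C|_{W_j}$ is a $d$-MSR code. Construction. Let $q$ be a power of $2$, let $\mu,n,r,d,N$ be positive integers with $r\le n$, and let $b=d+1-(n-r)\ge1$, $\ell=b^n$. For $\beta\in\mathbb F_q$ with multiplicative order $\mathcal O(\beta)\ge\max\{\mu N,bn\}$ put $\beta_{i,u}=\beta^{\,i-1+un}$ for $1\le i\le n$, $0\le u\le b-1$. Write $a\in[0,\ell-1]$ as $a=\sum_{i=1}^n a_i b^{i-1}$ with $0\le a_i\le b-1$. Let $\mathcal C(\mu,n,r,2,N,d;\ell)_q$ be the set of arrays in $\mathbb F_q^{\ell\times\mu n}$ whose $a$-th row $(c_{j,i})_{1\le j\le\mu,\,1\le i\le n}$ satisfies, for every $a\in[0,\ell-1]$,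 $$\sum_{i=1}^n\beta_{i,a_i}^{\,t}\,c_{j,i}=0\quad(1\le j\le\mu,\ 0\le t\le r-1),$$ $$\sum_{j=1}^{\mu}\sum_{i=1}^n\beta_{i,a_i}^{\,r}\,c_{j,i}=0,\qquad \sum_{j=1}^{\mu}\sum_{i=1}^n\beta^{-(j-1)N}\beta_{i,a_i}^{-1}\,c_{j,i}=0 .$$ Theorem. Let $\mu,n,r,d$ be positive integers with $r\le n$, $n-r\le d\le n-1$ and $2\le(n-r)(\mu-1)$; let $b=d+1-(n-r)$ and $N=rn$, and let $q\ge\max\{rn\mu,bn\}$ be a power of $2$. Then for every $\beta\in\mathbb F_q$ with $\mathcal O(\beta)\ge\max\{rn\mu,bn\}$, the code $\mathcal C(\mu,n,r,2,rn,d;b^n)_q$ is a locally $d$-MSR $\mathsf{SD}(\mu n,\mu,n,r,2;b^n)$ code over $\mathbb F_q$. Such a $\beta$ exists whenever $q>\max\{rn\mu,bn\}$. -/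

import Mathlib

/-! Array codes over `F` with subpacketization `ℓ` and nodes (columns) indexed by `ι` are
`F`-subspaces of the space of `ℓ × ι` matrices. -/

namespace ArrayCode

variable {F : Type*} [Field F] {ℓ : ℕ} {ι κ : Type*}

/-- Keep the columns `e k`, `k : κ`, of an array. -/
def selectCols (F : Type*) [Field F] (ℓ : ℕ) (e : κ → ι) :
    Matrix (Fin ℓ) ι F →ₗ[F] Matrix (Fin ℓ) κ F where
  toFun c := c.submatrix id e
  map_add' _ _ := rfl
  map_smul' _ _ := rfl

/-- The restriction of a code to the columns `e k`, `k : κ` (all other columns are punctured);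
`e` is meant to be injective. -/
def restrict (C : Submodule F (Matrix (Fin ℓ) ι F)) (e : κ → ι) :
    Submodule F (Matrix (Fin ℓ) κ F) :=
  C.map (selectCols F ℓ e)

/-- The weight of an array: its number of nonzero columns. -/
noncomputable def weight (c : Matrix (Fin ℓ) ι F) : ℕ :=
  {i : ι | ∃ a, c a i ≠ 0}.ncard

/-- `C` has minimum distance `δ` (which, `C` being linear, is its minimum nonzero weight). -/
def HasMinDist (C : Submodule F (Matrix (Fin ℓ) ι F)) (δ : ℕ) : Prop :=
  IsLeast {w : ℕ | ∃ c ∈ C, c ≠ 0 ∧ weight c = w} δ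

/-- `C` is a linear `[|ι|, k; ℓ]` array code: it has `|F| ^ (k ℓ)` words, i.e. dimension `k` when
one column is counted as one symbol. -/
def HasDim (C : Submodule F (Matrix (Fin ℓ) ι F)) (k : ℕ) : Prop :=
  Module.finrank F C = k * ℓ

/-- `C` is a `[|ι|, k, δ; ℓ]` MDS array code: the Singleton bound `δ ≤ |ι| - k + 1` is attained. -/
def IsMDS [Fintype ι] (C : Submodule F (Matrix (Fin ℓ) ι F)) (k δ : ℕ) : Prop :=
  HasDim C k ∧ HasMinDist C δ ∧ δ + k = Fintype.card ι + 1

/-- The nodes in `A` can be recovered by downloading `m` symbols of `F` in total from the nodes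
in `R`: each helper node `i ∈ R` sends `k i` symbols, an arbitrary function of its own content, and
the contents of all nodes in `A` are computed from what has been sent. -/
def CanRepair (C : Submodule F (Matrix (Fin ℓ) ι F)) (A R : Finset ι) (m : ℕ) : Prop :=
  ∃ (k : R → ℕ) (f : ∀ i : R, (Fin ℓ → F) → (Fin (k i) → F))
    (g : (∀ i : R, Fin (k i) → F) → (A → Fin ℓ → F)),
    ∑ i, k i = m ∧
      ∀ c ∈ C, ∀ j : A, g (fun i => f i (fun a => c a i)) j = fun a => c a j

/-- The repair bandwidth: the smallest number of symbols that have to be downloaded from the nodes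
in `R` to recover the nodes in `A` (`⊤` if recovery is impossible). -/
noncomputable def repairBandwidth (C : Submodule F (Matrix (Fin ℓ) ι F)) (A R : Finset ι) : ℕ∞ :=
  sInf {x : ℕ∞ | ∃ m : ℕ, x = m ∧ CanRepair C A R m}

/-- `C` is an `(h, d)`-MSR code with `r` parities: an `[|ι|, |ι| - r; ℓ]` MDS array code whose
largest repair bandwidth, over all disjoint sets of `h` failed and `d` helper nodes, equals
`h d ℓ / (h + d - |ι| + r)`. -/
def IsMSR [Fintype ι] (C : Submodule F (Matrix (Fin ℓ) ι F)) (r h d : ℕ) : Prop :=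
  IsMDS C (Fintype.card ι - r) (r + 1) ∧ h ≤ r ∧ Fintype.card ι - r ≤ d ∧
    ∃ M : ℕ,
      IsGreatest {x : ℕ∞ | ∃ A R : Finset ι, A.card = h ∧ R.card = d ∧ Disjoint A R ∧
        x = repairBandwidth C A R} M ∧
      (M : ℚ) = (h : ℚ) * d * ℓ / ((h : ℚ) + d - Fintype.card ι + r)

/-- `C` is a sector-disk code `SD(μ n, μ, n, r, s; ℓ)` with respect to the partition of its nodes
into the local groups `W j = {e (j, i) | i}`, `e (j, i)` being the `i`-th node of the `j`-th group.
The `r` nodes erased in each group sit at the same positions `E` in all groups. -/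
structure IsSDWith (C : Submodule F (Matrix (Fin ℓ) ι F)) {μ n : ℕ} (e : Fin μ × Fin n ≃ ι)
    (r s : ℕ) : Prop where
  pos : 0 < μ ∧ 0 < n ∧ 0 < r ∧ 0 < s ∧ 0 < ℓ
  r_le : r ≤ n
  s_le : s ≤ (n - r) * μ
  dim : HasDim C ((n - r) * μ - s)
  localMDS : ∀ j : Fin μ, IsMDS (restrict C (fun i : Fin n => e (j, i))) (n - r) (r + 1)
  globalMDS : ∀ E : Finset (Fin n), E.card = r →
    IsMDS (restrict C (fun p : Fin μ × {i : Fin n // i ∉ E} => e (p.1, p.2.1)))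
      ((n - r) * μ - s) (s + 1)

/-- `C` is a locally `(h, d)`-MSR sector-disk code `SD(μ n, μ, n, r, s; ℓ)`. -/
def IsLocallyMSRSD (C : Submodule F (Matrix (Fin ℓ) ι F)) (μ n r s h d : ℕ) : Prop :=
  ∃ e : Fin μ × Fin n ≃ ι, IsSDWith C e r s ∧
    ∀ j : Fin μ, IsMSR (restrict C (fun i : Fin n => e (j, i))) r h d

/-- `b = d + 1 - (n - r)`. -/
abbrev base (n r d : ℕ) : ℕ := d + 1 - (n - r)

/-- The locator of node `i` in row `a`. With `i` counted from `0` and `a = ∑ i, a_i b ^ i`,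
`0 ≤ a_i < b`, it is `β ^ (i + a_i n)`; the function `finFunctionFinEquiv.symm a` is `i ↦ a_i`. -/
def locator (β : F) {n b : ℕ} (a : Fin (b ^ n)) (i : Fin n) : F :=
  β ^ ((i : ℕ) + (finFunctionFinEquiv.symm a i : ℕ) * n)

/-- The `r × n` matrix `H₀⁽ᵃ⁾` of local parity checks, with rows `locator ^ t`, `0 ≤ t < r`. -/
def localParity (β : F) {n b : ℕ} (r : ℕ) (a : Fin (b ^ n)) : Matrix (Fin r) (Fin n) F :=
  Matrix.of fun t i => locator β a i ^ (t : ℕ)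

/-- The `2 × n` block of global parity checks of group `j` (counted from `0`), with rows
`locator ^ r` and `β ^ (- j N) * locator ⁻¹`. -/
def globalParity (β : F) {n b : ℕ} (r N : ℕ) (a : Fin (b ^ n)) (j : ℕ) :
    Matrix (Fin 2) (Fin n) F :=
  Matrix.of ![fun i => locator β a i ^ r, fun i => (β ^ (j * N))⁻¹ * (locator β a i)⁻¹]

/-- The `(r μ + 2) × μ n` parity-check matrix `H⁽ᵃ⁾`: `μ` diagonal copies of `H₀⁽ᵃ⁾` on top of the
global parity checks. -/
def parityCheck (β : F) {n b : ℕ} (μ r N : ℕ) (a : Fin (b ^ n)) :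
    Matrix ((Fin μ × Fin r) ⊕ Fin 2) (Fin μ × Fin n) F :=
  Matrix.fromRows
    (Matrix.of fun p c => if p.1 = c.1 then localParity β r a p.2 c.2 else 0)
    (Matrix.of fun t c => globalParity β r N a (c.1 : ℕ) t c.2)

/-- The array code `C(μ, n, r, 2, N, d; ℓ)` with `ℓ = b ^ n` rows, `b = d + 1 - (n - r)`: the arrays
whose `a`-th row lies in the kernel of `H⁽ᵃ⁾`, for all `a`. -/
def sdCode (β : F) (μ n r N d : ℕ) :
    Submodule F (Matrix (Fin (base n r d ^ n)) (Fin μ × Fin n) F) where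
  carrier := {c | ∀ a, (parityCheck β μ r N a).mulVec (c a) = 0}
  add_mem' {x y} hx hy a := by
    have h : (x + y) a = x a + y a := rfl
    rw [h, Matrix.mulVec_add, hx a, hy a, add_zero]
  zero_mem' a := Matrix.mulVec_zero _
  smul_mem' t x hx a := by
    have h : (t • x) a = t • x a := rfl
    rw [h, Matrix.mulVec_smul, hx a, smul_zero]

end ArrayCode

/-! The code is a product of scalar codes, one for each row `a`, so everything except repair is
checked row by row.

Global erasures. Erase the same `r` positions `E` in all groups and two further nodes. A group
without a further node vanishes by Vandermonde. If one group contains both, its moments of orders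
`-1, ..., r` vanish, which is a Vandermonde system with `r + 2` rows. If they lie in different
groups `j`, `j'`, each group is a word supported on `E` and one more position `i`, and its `r`-th
moment is its `(-1)`-st moment times `loc i * ∏ k ∈ E, -loc k` (`sum_pow_card_mul_eq`). The product
over `E` is the same for both groups and cancels. The two global checks become a `2 × 2` system with
determinant `v j * loc i - v j' * loc i'` up to sign, where `v j = β ^ (j * N)`. It is nonzero
because the exponents of `β` have different leading base-`N` digits `j`, `j'` and stay below the
order of `β`.

Local repair. The rows that differ only in the digit of the failed node are added. Every other node
keeps its locator, while the failed node shows `b` distinct ones, so the sums form a word of a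
longer Vandermonde code whose unknown places number exactly `r`
(`localCode_eq_zero_of_sum_eq_zero`). The cut-set bound `CanRepair.cutSet` shows that this bandwidth
is optimal. The argument applies to the groups because each of them restricts to the full local code
(`map_group_ker_parityCheck`). -/

namespace ArrayCode
open Polynomial

/-! ### Vandermonde systems and moments of words of small weight. -/

section Vandermonde

variable {F ι : Type*} [Field F] [Fintype ι]

theorem sum_eval_mul_eq_zero (loc x : ι → F) {m : ℕ}
    (h : ∀ t < m, ∑ i, loc i ^ t * x i = 0) (p : F[X]) (hp : p.natDegree < m) :
    ∑ i, p.eval (loc i) * x i = 0 := by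
  simp_rw [eval_eq_sum_range, Finset.sum_mul]
  rw [Finset.sum_comm]
  refine Finset.sum_eq_zero fun t ht => ?_
  simp_rw [mul_assoc, ← Finset.mul_sum]
  rw [h t (by have := Finset.mem_range.1 ht; omega), mul_zero]

/-- A word in the kernel of a Vandermonde matrix with `m` rows and at most `m` nonzero entries
vanishes. -/
theorem eq_zero_of_sum_pow_mul_eq_zero (loc x : ι → F) (hloc : Function.Injective loc) {m : ℕ}
    (h : ∀ t < m, ∑ i, loc i ^ t * x i = 0) (S : Finset ι) (hS : S.card ≤ m)
    (hx : ∀ i ∉ S, x i = 0) : x = 0 := by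
  classical
  funext i
  by_cases hi : i ∈ S
  swap
  · exact hx i hi
  -- `p` vanishes at all locators of the support except that of `i`, so pairing it with `x` isolates
  -- `x i`.
  set p : F[X] := ∏ k ∈ S.erase i, (X - C (loc k)) with hp
  have hdeg : p.natDegree < m := by
    rw [hp, natDegree_prod_of_monic _ _ fun k _ => monic_X_sub_C _]
    have := Finset.card_pos.2 ⟨i, hi⟩
    simp [Finset.card_erase_of_mem hi]
    omega
  have hsum := sum_eval_mul_eq_zero loc x h p hdeg
  rw [Finset.sum_eq_single i] at hsum
  · refine (mul_eq_zero.1 hsum).resolve_left ?_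
    rw [hp, eval_prod]
    refine Finset.prod_ne_zero_iff.2 ?_
    intro k hk
    simpa [sub_eq_zero] using fun e => (Finset.ne_of_mem_erase hk) (hloc e).symm
  · intro k _ hk
    by_cases hkS : k ∈ S
    · rw [hp, eval_prod, Finset.prod_eq_zero (Finset.mem_erase.2 ⟨hk, hkS⟩) (by simp), zero_mul]
    · rw [hx k hkS, mul_zero]
  · simp

/-- The two extreme moments of a word of weight `r + 1` whose moments `0, …, r - 1` vanish. -/
theorem sum_pow_card_mul_eq (loc x : ι → F) (hloc : ∀ i, loc i ≠ 0) (E : Finset ι)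
    (h : ∀ t < E.card, ∑ i, loc i ^ t * x i = 0) (i₀ : ι) (hx : ∀ i ∉ E, i ≠ i₀ → x i = 0) :
    ∑ i, loc i ^ E.card * x i = loc i₀ * (∏ k ∈ E, -loc k) * ∑ i, (loc i)⁻¹ * x i := by
  -- `p` vanishes on the support of `x`. Pairing `p(X) / X` with `x` gives a relation between the
  -- moments `-1, ..., E.card` in which only the two extreme ones survive.
  set p : F[X] := (X - C (loc i₀)) * ∏ k ∈ E, (X - C (loc k)) with hp
  have hE : (∏ k ∈ E, (X - C (loc k))).Monic := monic_prod_of_monic _ _ fun k _ => monic_X_sub_C _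
  have hmon : p.Monic := (monic_X_sub_C _).mul hE
  have hdeg : p.natDegree = E.card + 1 := by
    rw [hp, (monic_X_sub_C _).natDegree_mul hE,
      natDegree_prod_of_monic _ _ fun k _ => monic_X_sub_C _]
    simp [add_comm]
  have h0 : p.coeff 0 = -(loc i₀ * ∏ k ∈ E, -loc k) := by
    rw [coeff_zero_eq_eval_zero, hp]
    simp [eval_prod]
  have h1 : p.coeff (E.card + 1) = 1 := by rw [← hdeg]; exact hmon
  have hsum : ∑ i, p.eval (loc i) * ((loc i)⁻¹ * x i) = 0 := by
    refine Finset.sum_eq_zero fun i _ => ?_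
    by_cases hi : i = i₀
    · subst hi; simp [hp]
    by_cases hiE : i ∈ E
    · have : p.eval (loc i) = 0 := by
        rw [hp, eval_mul, eval_prod, Finset.prod_eq_zero hiE (by simp), mul_zero]
      rw [this, zero_mul]
    · rw [hx i hiE hi]; simp
  simp_rw [eval_eq_sum_range, Finset.sum_mul] at hsum
  rw [Finset.sum_comm, hdeg, Finset.sum_range_succ, Finset.sum_range_succ',
    Finset.sum_eq_zero] at hsum
  · simp_rw [mul_assoc, ← Finset.mul_sum] at hsum
    rw [h0, h1] at hsum
    have h2 : ∀ i, loc i ^ (E.card + 1) * ((loc i)⁻¹ * x i) = loc i ^ E.card * x i := fun i => by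
      have := hloc i; field_simp; ring
    simp_rw [h2] at hsum
    simp only [pow_zero, one_mul] at hsum
    linear_combination hsum
  · intro t ht
    rw [← h t (Finset.mem_range.1 ht) |> fun e => (mul_eq_zero_of_right (p.coeff (t + 1)) e),
      Finset.mul_sum]
    refine Finset.sum_congr rfl fun i _ => ?_
    have := hloc i
    field_simp
    ring

end Vandermonde

/-! ### Sector-disk erasures in a single row. -/

section SectorDisk

variable {F : Type*} [Field F] {μ n : ℕ}

/-- The erasure of a common set `E` of positions in all groups and of two further nodes is
correctable. -/
theorem eq_zero_of_moments (loc : Fin n → F) (hinj : Function.Injective loc)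
    (hloc : ∀ i, loc i ≠ 0) (v : Fin μ → F) (hv : ∀ j, v j ≠ 0)
    (hsep : ∀ j j' i i', j ≠ j' → v j * loc i ≠ v j' * loc i')
    (E : Finset (Fin n)) (x : Fin μ × Fin n → F)
    (hl : ∀ j, ∀ t < E.card, ∑ i, loc i ^ t * x (j, i) = 0)
    (hA : ∑ j, ∑ i, loc i ^ E.card * x (j, i) = 0)
    (hB : ∑ j, ∑ i, (v j)⁻¹ * (loc i)⁻¹ * x (j, i) = 0)
    (p p' : Fin μ × Fin n) (hx : ∀ s, s.2 ∉ E → s ≠ p → s ≠ p' → x s = 0) : x = 0 := by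
  obtain ⟨j, i⟩ := p
  obtain ⟨j', i'⟩ := p'
  simp_rw [mul_assoc, ← Finset.mul_sum] at hB
  suffices H : ∀ k, (fun i => x (k, i)) = 0 from funext fun s => congrFun (H s.1) s.2
  have hother : ∀ k, k ≠ j → k ≠ j' → (fun i => x (k, i)) = 0 := fun k h1 h2 =>
    eq_zero_of_sum_pow_mul_eq_zero loc _ hinj (hl k) E le_rfl fun l hlE =>
      hx _ hlE (by simp [h1]) (by simp [h2])
  have hother' : ∀ k, k ≠ j → k ≠ j' → ∀ l, x (k, l) = 0 := fun k h1 h2 l =>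
    congrFun (hother k h1 h2) l
  by_cases hjj : j = j'
  · subst hjj
    rw [Finset.sum_eq_single j (fun k _ hk => by simp [hother' k hk hk]) (by simp)] at hA hB
    have hB' := (mul_eq_zero.1 hB).resolve_left (inv_ne_zero (hv j))
    -- Dividing the word by its locators shifts the moments `-1, ..., E.card` to `0, ..., E.card +
    -- 1`.
    have key : (fun l => (loc l)⁻¹ * x (j, l)) = 0 := by
      refine eq_zero_of_sum_pow_mul_eq_zero loc _ hinj (m := E.card + 2) ?_
        (insert i (insert i' E)) ?_ ?_
      · intro t ht
        rcases t with _ | t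
        · simpa using hB'
        · have h2 : ∀ l, loc l ^ (t + 1) * ((loc l)⁻¹ * x (j, l)) = loc l ^ t * x (j, l) :=
            fun l => by have := hloc l; field_simp; ring
          simp_rw [h2]
          rcases Nat.lt_or_ge t E.card with h3 | h3
          · exact hl j t h3
          · obtain rfl : t = E.card := by omega
            exact hA
      · exact (Finset.card_insert_le _ _).trans (Nat.succ_le_succ (Finset.card_insert_le _ _))
      · intro l hlS
        simp only [Finset.mem_insert, not_or] at hlS
        rw [hx (j, l) hlS.2.2 (by simp [hlS.1]) (by simp [hlS.2.1]), mul_zero]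
    intro k
    by_cases hk : k = j
    · subst hk
      funext l
      exact (mul_eq_zero.1 (congrFun key l)).resolve_left (inv_ne_zero (hloc l))
    · exact hother k hk hk
  · rw [Finset.sum_eq_add j j' hjj (fun k _ hk => by simp [hother' k hk.1 hk.2]) (by simp)
      (by simp)] at hA hB
    have h1 := sum_pow_card_mul_eq loc (fun l => x (j, l)) hloc E (hl j) i fun l hlE hli =>
      hx _ hlE (by simp [hli]) (by simp [hjj])
    have h2 := sum_pow_card_mul_eq loc (fun l => x (j', l)) hloc E (hl j') i' fun l hlE hli =>
      hx _ hlE (by simp [Ne.symm hjj]) (by simp [hli])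
    have hP : ∏ k ∈ E, -loc k ≠ 0 := Finset.prod_ne_zero_iff.2 fun k _ => neg_ne_zero.2 (hloc k)
    have hs := hsep j j' i i' hjj
    have hvj := hv j
    have hvj' := hv j'
    set B := ∑ l, (loc l)⁻¹ * x (j, l)
    set B' := ∑ l, (loc l)⁻¹ * x (j', l)
    set P := ∏ k ∈ E, -loc k
    rw [h1, h2] at hA
    -- The factor `P` is common to both groups, since `E` and the locators do not depend on the
    -- group.
    have e1 : loc i * B + loc i' * B' = 0 :=
      (mul_eq_zero.1 (show P * (loc i * B + loc i' * B') = 0 by linear_combination hA)).resolve_left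
        hP
    have e2 : v j' * B + v j * B' = 0 := by
      have : v j * v j' * ((v j)⁻¹ * B + (v j')⁻¹ * B') = 0 := by rw [hB, mul_zero]
      field_simp at this
      linear_combination this
    have hB0 : B = 0 := (mul_eq_zero.1
      (show (v j * loc i - v j' * loc i') * B = 0 by
        linear_combination v j * e1 - loc i' * e2)).resolve_left (sub_ne_zero.2 hs)
    have hB0' : B' = 0 := by
      rw [hB0, mul_zero, zero_add] at e2
      exact (mul_eq_zero.1 e2).resolve_left hvj
    rw [hB0, mul_zero] at h1
    rw [hB0', mul_zero] at h2
    -- Both extreme moments now vanish, so each of the two groups satisfies `E.card + 1` Vandermonde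
    -- equations, enough for `E` and one further position.
    have fin : ∀ k l₀, (∑ l, loc l ^ E.card * x (k, l) = 0) →
        (∀ l ∉ E, l ≠ l₀ → x (k, l) = 0) → (fun l => x (k, l)) = 0 := by
      intro k l₀ hk hxk
      refine eq_zero_of_sum_pow_mul_eq_zero loc _ hinj (m := E.card + 1) ?_ (insert l₀ E)
        (Finset.card_insert_le _ _) ?_
      · intro t ht
        rcases Nat.lt_succ_iff_lt_or_eq.1 ht with h3 | rfl
        · exact hl k t h3
        · exact hk
      · intro l hlS
        simp only [Finset.mem_insert, not_or] at hlS
        exact hxk l hlS.2 hlS.1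
    intro k
    by_cases hk : k = j
    · subst hk
      exact fin k i h1 fun l hlE hli => hx _ hlE (by simp [hli]) (by simp [hjj])
    by_cases hk' : k = j'
    · subst hk'
      exact fin k i' h2 fun l hlE hli => hx _ hlE (by simp [Ne.symm hjj]) (by simp [hli])
    · exact hother k hk hk'

end SectorDisk

/-! ### Array codes defined row by row, and the MDS property. -/

section RowCode

variable {F : Type*} [Field F] {ℓ : ℕ} {ι κ : Type*}

/-- The array code whose `a`-th rows are the words of `K a`. -/
def rowCode (K : Fin ℓ → Submodule F (ι → F)) : Submodule F (Matrix (Fin ℓ) ι F) where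
  carrier := {c | ∀ a, c a ∈ K a}
  add_mem' hx hy a := (K a).add_mem (hx a) (hy a)
  zero_mem' a := (K a).zero_mem
  smul_mem' t _ hx a := (K a).smul_mem t (hx a)

theorem finrank_rowCode [Fintype ι] (K : Fin ℓ → Submodule F (ι → F)) :
    Module.finrank F (rowCode K) = ∑ a, Module.finrank F (K a) := by
  let e : rowCode K ≃ₗ[F] (∀ a, K a) :=
    { toFun := fun c a => ⟨c.1 a, c.2 a⟩
      map_add' := fun _ _ => rfl
      map_smul' := fun _ _ => rfl
      invFun := fun c => ⟨fun a => (c a).1, fun a => (c a).2⟩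
      left_inv := fun _ => rfl
      right_inv := fun _ => rfl }
  rw [e.finrank_eq, Module.finrank_pi_fintype]

theorem restrict_rowCode (K : Fin ℓ → Submodule F (ι → F)) (e : κ → ι) :
    restrict (rowCode K) e = rowCode fun a => (K a).map (LinearMap.funLeft F F e) := by
  ext c
  constructor
  · rintro ⟨c, hc, rfl⟩ a
    exact ⟨c a, hc a, rfl⟩
  · intro hc
    choose x hx hxc using hc
    exact ⟨x, hx, funext hxc⟩

/-- A nonzero word of `K` never vanishes at `k` coordinates. -/
def Separated (K : Submodule F (ι → F)) (k : ℕ) : Prop :=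
  ∀ U : Finset ι, U.card = k → ∀ x ∈ K, (∀ i ∈ U, x i = 0) → x = 0

theorem Separated.finrank_le [Fintype ι] {K : Submodule F (ι → F)} {k : ℕ} (hK : Separated K k)
    (hk : k ≤ Fintype.card ι) : Module.finrank F K ≤ k := by
  obtain ⟨U, -, hU⟩ := Finset.exists_subset_card_eq (s := (Finset.univ : Finset ι))
    (by simpa using hk)
  let f : K →ₗ[F] (U → F) := (LinearMap.funLeft F F ((↑) : U → ι)).comp K.subtype
  have hf : Function.Injective f := by
    rw [← LinearMap.ker_eq_bot, LinearMap.ker_eq_bot']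
    intro x hx
    exact Subtype.ext (hK U hU x x.2 fun i hi => congrFun hx ⟨i, hi⟩)
  simpa [hU] using LinearMap.finrank_le_finrank_of_injective hf

/-- Any `k` coordinates are an information set of an MDS code of dimension `k`. -/
theorem Separated.exists_eq_on [Fintype ι] {K : Submodule F (ι → F)} {k : ℕ} (hK : Separated K k)
    (hdim : Module.finrank F K = k) (U : Finset ι) (hU : U.card = k) (y : ι → F) :
    ∃ x ∈ K, ∀ i ∈ U, x i = y i := by
  let f : K →ₗ[F] (U → F) := (LinearMap.funLeft F F ((↑) : U → ι)).comp K.subtype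
  have hf : Function.Injective f := by
    rw [← LinearMap.ker_eq_bot, LinearMap.ker_eq_bot']
    intro x hx
    exact Subtype.ext (hK U hU x x.2 fun i hi => congrFun hx ⟨i, hi⟩)
  have hs : Function.Surjective f :=
    (LinearMap.injective_iff_surjective_of_finrank_eq_finrank (by simp [hdim, hU])).1 hf
  obtain ⟨x, hx⟩ := hs fun i => y i
  exact ⟨x, x.2, fun i hi => congrFun hx ⟨i, hi⟩⟩

/-- Separation in every row forbids `k` common zero columns, which bounds the distance below. A
single nonzero row attains the bound. -/
theorem isMDS_rowCode [Fintype ι] (K : Fin ℓ → Submodule F (ι → F)) {k δ : ℕ} (hℓ : 0 < ℓ)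
    (hk : 0 < k) (hdim : ∀ a, Module.finrank F (K a) = k) (hK : ∀ a, Separated (K a) k)
    (hδ : δ + k = Fintype.card ι + 1) : IsMDS (rowCode K) k δ := by
  classical
  have hlow : ∀ c ∈ rowCode K, c ≠ 0 → δ ≤ weight c := by
    intro c hc hne
    by_contra! hlt
    apply hne
    have hcard : k ≤ (Finset.univ.filter fun i => ¬ ∃ a, c a i ≠ 0).card := by
      have h1 := Finset.card_filter_add_card_filter_not (s := (Finset.univ : Finset ι))
        (fun i => ∃ a, c a i ≠ 0)
      rw [weight, Set.ncard_eq_toFinset_card', Set.toFinset_ofPred] at hlt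
      rw [Finset.card_univ] at h1
      omega
    obtain ⟨U, hU, hUk⟩ := Finset.exists_subset_card_eq hcard
    funext a
    refine hK a U hUk (c a) (hc a) fun i hi => ?_
    have := (Finset.mem_filter.1 (hU hi)).2
    push Not at this
    exact this a
  refine ⟨by simp [HasDim, finrank_rowCode, hdim, mul_comm], ⟨?_, ?_⟩, hδ⟩
  -- Vanishing on `k - 1` coordinates leaves a nonzero word in a `k`-dimensional row code; it is
  -- placed in row `0` with zeros in the other rows.
  · obtain ⟨U, -, hU⟩ := Finset.exists_subset_card_eq (s := (Finset.univ : Finset ι)) (n := k - 1)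
      (by rw [Finset.card_univ]; have := (Submodule.finrank_le (K ⟨0, hℓ⟩)); simp [hdim] at this
          omega)
    let f : K ⟨0, hℓ⟩ →ₗ[F] (U → F) := (LinearMap.funLeft F F ((↑) : U → ι)).comp
      (K ⟨0, hℓ⟩).subtype
    have hker : LinearMap.ker f ≠ ⊥ := LinearMap.ker_ne_bot_of_finrank_lt (by
      simp [hU, hdim]; omega)
    obtain ⟨x, hx, hx0⟩ := Submodule.exists_mem_ne_zero_of_ne_bot hker
    let c : Matrix (Fin ℓ) ι F := Function.update 0 ⟨0, hℓ⟩ x.1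
    have hcC : c ∈ rowCode K := by
      intro a
      by_cases ha : a = ⟨0, hℓ⟩
      · subst ha; simp [c]
      · simp [c, ha]
    have hc0 : c ≠ 0 := fun h => hx0 (Subtype.ext (by
      have := congrFun h ⟨0, hℓ⟩
      simp only [c, Function.update_self] at this
      exact this))
    refine ⟨c, hcC, hc0, le_antisymm ?_ (hlow c hcC hc0)⟩
    have hsub : {i | ∃ a, c a i ≠ 0} ⊆ ((Uᶜ : Finset ι) : Set ι) := by
      rintro i ⟨a, ha⟩
      rw [Finset.mem_coe, Finset.mem_compl]
      intro hi
      apply ha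
      by_cases h : a = ⟨0, hℓ⟩
      · subst h
        simp only [c, Function.update_self]
        exact congrFun (LinearMap.mem_ker.1 hx) ⟨i, hi⟩
      · simp [c, h]
    have := Set.ncard_le_ncard hsub (Finset.finite_toSet _)
    rw [Set.ncard_coe_finset, Finset.card_compl, hU] at this
    exact this.trans (by omega)
  · rintro w ⟨c, hc, hc0, rfl⟩
    exact hlow c hc hc0

end RowCode

/-! ### The cut-set bound and linear repair schemes. -/

section CutSet

/-- If every `b` of the `d` values of `k` have sum at least `m`, all of them have sum at least
`d * m / b`. -/
theorem card_mul_le_mul_sum {ι : Type*} [Fintype ι] (k : ι → ℕ) {b m : ℕ}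
    (hb : b ≤ Fintype.card ι) (h : ∀ B : Finset ι, B.card = b → m ≤ ∑ i ∈ B, k i) :
    Fintype.card ι * m ≤ b * ∑ i, k i := by
  classical
  rcases Nat.eq_zero_or_pos (Fintype.card ι) with h0 | hpos
  · simp [h0]
  have : NeZero (Fintype.card ι) := ⟨hpos.ne'⟩
  let e : Fin (Fintype.card ι) ≃ ι := (Fintype.equivFin ι).symm
  obtain ⟨T, -, hT⟩ := Finset.exists_subset_card_eq
    (s := (Finset.univ : Finset (Fin (Fintype.card ι)))) (n := b) (by simpa using hb)
  -- The cyclic shifts of one `b`-set `T` cover every index exactly `b` times, so summing over them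
  -- suffices.
  have hshift : ∀ t, m ≤ ∑ s ∈ T, k (e (s + t)) := fun t => by
    have := h (T.map ((Equiv.addRight t).trans e).toEmbedding) (by simpa using hT)
    simpa using this
  calc Fintype.card ι * m = ∑ _t : Fin (Fintype.card ι), m := by simp
    _ ≤ ∑ t, ∑ s ∈ T, k (e (s + t)) := Finset.sum_le_sum fun t _ => hshift t
    _ = ∑ s ∈ T, ∑ t, k (e (s + t)) := Finset.sum_comm
    _ = ∑ _s ∈ T, ∑ i, k i := Finset.sum_congr rfl fun s _ =>
        ((Equiv.addLeft s).trans e).sum_comp k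
    _ = b * ∑ i, k i := by simp [hT]

/-- The cut-set bound for the repair of one node of a code in which every `κ` nodes are an
information set. -/
theorem CanRepair.cutSet {F : Type*} [Field F] [Fintype F] {ℓ : ℕ} {ι : Type*} [DecidableEq ι]
    {C : Submodule F (Matrix (Fin ℓ) ι F)} {κ b m : ℕ}
    (hC : ∀ U : Finset ι, U.card = κ → ∀ y : Matrix (Fin ℓ) ι F, ∃ c ∈ C, ∀ a, ∀ i ∈ U,
      c a i = y a i)
    {i₀ : ι} {R : Finset ι} (hi : i₀ ∉ R) (hb : b ≤ R.card) (hκ : R.card + 1 = κ + b)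
    (h : CanRepair C {i₀} R m) : R.card * ℓ ≤ b * m := by
  classical
  obtain ⟨k, f, g, rfl, hg⟩ := h
  rw [← Fintype.card_coe R]
  refine card_mul_le_mul_sum k (by simpa using hb) fun B hB => ?_
  -- The helpers outside `B` together with `i₀` form an information set. Codewords can thus be zero
  -- on `D` and arbitrary at `i₀`, so the messages from `B` alone must distinguish all contents of
  -- `i₀`.
  let D : Finset ι := Bᶜ.map (Function.Embedding.subtype _)
  have hDcard : D.card = R.card - b := by simp [D, Finset.card_compl, hB]
  have hiD : i₀ ∉ D := by
    intro hm
    obtain ⟨x, -, rfl⟩ := Finset.mem_map.1 hm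
    exact hi x.2
  have hU : (insert i₀ D).card = κ := by
    rw [Finset.card_insert_of_notMem hiD, hDcard]; omega
  choose c hcC hc using fun y : Fin ℓ → F =>
    hC (insert i₀ D) hU fun a i => if i = i₀ then y a else 0
  let msg : (Fin ℓ → F) → (∀ i : B, Fin (k i) → F) := fun y i => f i fun a => c y a i
  have hmsg : Function.Injective msg := by
    intro y y' hyy
    have hall : (fun i : R => f i fun a => c y a i) = fun i : R => f i fun a => c y' a i := by
      funext i
      by_cases hiB : i ∈ B
      · exact congrFun hyy ⟨i, hiB⟩
      · have hD : (i : ι) ∈ insert i₀ D := Finset.mem_insert_of_mem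
          (Finset.mem_map.2 ⟨i, by simpa using hiB, rfl⟩)
        have hne : (i : ι) ≠ i₀ := fun e => hi (e ▸ i.2)
        congr 1
        funext a
        rw [hc y a i hD, hc y' a i hD, if_neg hne, if_neg hne]
    have h1 := hg (c y) (hcC y) ⟨i₀, by simp⟩
    have h2 := hg (c y') (hcC y') ⟨i₀, by simp⟩
    rw [hall, h2] at h1
    funext a
    have h3 := congrFun h1 a
    simp only at h3
    rw [hc y a i₀ (by simp), hc y' a i₀ (by simp), if_pos rfl, if_pos rfl] at h3
    exact h3.symm
  have hle := Fintype.card_le_of_injective msg hmsg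
  simp only [Fintype.card_pi, Finset.prod_const, Finset.card_univ, Fintype.card_fin,
    Finset.prod_pow_eq_pow_sum] at hle
  have := (Nat.pow_le_pow_iff_right Fintype.one_lt_card).1 hle
  rwa [Finset.univ_eq_attach, Finset.sum_attach B k] at this

/-- Codewords with equal messages differ by a codeword with zero messages, so decoding may pick any
codeword consistent with the messages. Messages that no codeword produces are sent to `0`. -/
theorem canRepair_of_linear {F : Type*} [Field F] {ℓ : ℕ} {ι : Type*}
    {C : Submodule F (Matrix (Fin ℓ) ι F)} (A R : Finset ι) (m : ℕ)
    (f : (Fin ℓ → F) →ₗ[F] (Fin m → F))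
    (h : ∀ c ∈ C, (∀ i ∈ R, f (fun a => c a i) = 0) → ∀ j ∈ A, ∀ a, c a j = 0) :
    CanRepair C A R (R.card * m) := by
  classical
  refine ⟨fun _ => m, fun _ => f, fun y j =>
    if hy : ∃ c ∈ C, (fun i : R => f fun a => c a i) = y then fun a => hy.choose a j else 0,
    by simp, fun c hc j => ?_⟩
  have hy : ∃ c' ∈ C, (fun i : R => f fun a => c' a i) = fun i : R => f fun a => c a i :=
    ⟨c, hc, rfl⟩
  simp only
  rw [dif_pos hy]
  funext a
  have h1 := h _ (C.sub_mem hy.choose_spec.1 hc) (fun i hi => by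
    have := congrFun hy.choose_spec.2 ⟨i, hi⟩
    have e : (fun a => (hy.choose - c) a i) = (fun a => hy.choose a i) - fun a => c a i := rfl
    rw [e, map_sub, sub_eq_zero]
    exact this) j j.2 a
  exact sub_eq_zero.1 h1

end CutSet

/-! ### The local code: MDS property and optimal repair. -/

section Code

variable {F : Type*} [Field F]

theorem finrank_ker_mulVecLin_ge {ι κ : Type*} [Fintype ι] [Fintype κ] (H : Matrix κ ι F) :
    Fintype.card ι - Fintype.card κ ≤ Module.finrank F (LinearMap.ker H.mulVecLin) := by
  have h1 := LinearMap.finrank_range_add_finrank_ker H.mulVecLin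
  have h2 := Submodule.finrank_le (LinearMap.range H.mulVecLin)
  simp only [Module.finrank_fintype_fun_eq_card] at h1 h2
  omega

/-- All exponents lie below the order of `β`, so they can be compared as integers, digit by digit in
base `n`. This serves both for the locators and, with `N` and `μ` in place of `n` and `b`, for
separating the groups. -/
theorem pow_add_mul_inj {β : F} {n b i i' u u' : ℕ} (hβ : b * n ≤ orderOf β) (hi : i < n)
    (hi' : i' < n) (hu : u < b) (hu' : u' < b) (h : β ^ (i + u * n) = β ^ (i' + u' * n)) :
    i = i' ∧ u = u' := by
  have hlt : ∀ {i u : ℕ}, i < n → u < b → i + u * n < orderOf β := fun {i u} hi hu => by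
    have : (u + 1) * n ≤ b * n := Nat.mul_le_mul_right n hu
    rw [add_mul, one_mul] at this
    omega
  have h1 := pow_injOn_Iio_orderOf (Set.mem_Iio.2 (hlt hi hu)) (Set.mem_Iio.2 (hlt hi' hu')) h
  have h2 : i = i' := by
    have := congrArg (· % n) h1
    simpa [Nat.mod_eq_of_lt hi, Nat.mod_eq_of_lt hi'] using this
  subst h2
  exact ⟨rfl, Nat.eq_of_mul_eq_mul_right (by omega) (by omega : u * n = u' * n)⟩

theorem locator_injective {β : F} {n b : ℕ} (hβ : b * n ≤ orderOf β) (a : Fin (b ^ n)) :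
    Function.Injective (locator β a) := fun i i' h =>
  Fin.ext (pow_add_mul_inj hβ i.2 i'.2 (Fin.is_lt _) (Fin.is_lt _) h).1

theorem mem_ker_localParity {β : F} {n b r : ℕ} {a : Fin (b ^ n)} {x : Fin n → F} :
    x ∈ LinearMap.ker (localParity β r a).mulVecLin ↔
      ∀ t < r, ∑ i, locator β a i ^ t * x i = 0 := by
  rw [LinearMap.mem_ker, Matrix.mulVecLin_apply]
  exact ⟨fun h t ht => congrFun h ⟨t, ht⟩, fun h => funext fun t => h t t.2⟩

/-- The code of one local group. -/
def localCode (β : F) (n b r : ℕ) : Submodule F (Matrix (Fin (b ^ n)) (Fin n) F) :=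
  rowCode fun a => LinearMap.ker (localParity β r a).mulVecLin

theorem separated_ker_localParity {β : F} {n b r : ℕ} (hβ : b * n ≤ orderOf β) (hr : r ≤ n)
    (a : Fin (b ^ n)) : Separated (LinearMap.ker (localParity β r a).mulVecLin) (n - r) := by
  intro U hU x hx hxU
  exact eq_zero_of_sum_pow_mul_eq_zero (locator β a) x (locator_injective hβ a)
    (mem_ker_localParity.1 hx) Uᶜ (by rw [Finset.card_compl, hU, Fintype.card_fin]; omega)
    fun i hi => hxU i (by simpa using hi)

theorem finrank_ker_localParity {β : F} {n b r : ℕ} (hβ : b * n ≤ orderOf β) (hr : r ≤ n)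
    (a : Fin (b ^ n)) :
    Module.finrank F (LinearMap.ker (localParity β r a).mulVecLin) = n - r := by
  refine le_antisymm ((separated_ker_localParity hβ hr a).finrank_le (by simp)) ?_
  simpa using finrank_ker_mulVecLin_ge (localParity β r a)

theorem isMDS_localCode {β : F} {n b r : ℕ} (hβ : b * n ≤ orderOf β) (hb : 0 < b) (hr : r < n) :
    IsMDS (localCode β n b r) (n - r) (r + 1) :=
  isMDS_rowCode _ (pow_pos hb n) (by omega) (finrank_ker_localParity hβ hr.le)
    (separated_ker_localParity hβ hr.le) (by rw [Fintype.card_fin]; omega)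

theorem localCode_exists_eq_on {β : F} {n b r : ℕ} (hβ : b * n ≤ orderOf β) (hr : r ≤ n)
    (U : Finset (Fin n)) (hU : U.card = n - r) (y : Matrix (Fin (b ^ n)) (Fin n) F) :
    ∃ c ∈ localCode β n b r, ∀ a, ∀ i ∈ U, c a i = y a i := by
  choose c hc hcy using fun a =>
    (separated_ker_localParity hβ hr a).exists_eq_on (finrank_ker_localParity hβ hr a) U hU (y a)
  exact ⟨c, hc, hcy⟩

/-- The row whose digits are `u` at the place `i₀` and `g` elsewhere. -/
def rowOf {n b : ℕ} (i₀ : Fin n) (g : {i // i ≠ i₀} → Fin b) (u : Fin b) : Fin (b ^ n) :=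
  finFunctionFinEquiv fun i => if h : i = i₀ then u else g ⟨i, h⟩

theorem exists_rowOf {n b : ℕ} (i₀ : Fin n) (a : Fin (b ^ n)) : ∃ g u, rowOf i₀ g u = a :=
  ⟨fun i => finFunctionFinEquiv.symm a i, finFunctionFinEquiv.symm a i₀, by
    rw [rowOf, ← Equiv.eq_symm_apply]
    funext i
    by_cases h : i = i₀
    · subst h; simp
    · simp [h]⟩

/-- The failed node `i₀` is determined by the sums over the digit `i₀` of the contents of any `d`
other nodes. -/
theorem localCode_eq_zero_of_sum_eq_zero {β : F} {n b r d : ℕ} (hβ : b * n ≤ orderOf β)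
    (hdim : d + r + 1 = n + b) {c : Matrix (Fin (b ^ n)) (Fin n) F} (hc : c ∈ localCode β n b r)
    {i₀ : Fin n} {R : Finset (Fin n)} (hi : i₀ ∉ R) (hR : R.card = d)
    (h : ∀ i ∈ R, ∀ g, ∑ u, c (rowOf i₀ g u) i = 0) (a : Fin (b ^ n)) : c a i₀ = 0 := by
  classical
  obtain ⟨g, u₀, rfl⟩ := exists_rowOf i₀ a
  -- Locators of the summed word, of length `n - 1 + b`: the digits `g` fix one locator for each
  -- surviving node, and the failed node contributes one for each value of its digit.
  let loc : {i // i ≠ i₀} ⊕ Fin b → F :=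
    Sum.elim (fun i => β ^ (((i : Fin n) : ℕ) + (g i : ℕ) * n))
      fun u => β ^ ((i₀ : ℕ) + (u : ℕ) * n)
  let x : {i // i ≠ i₀} ⊕ Fin b → F :=
    Sum.elim (fun i => ∑ u, c (rowOf i₀ g u) i) fun u => c (rowOf i₀ g u) i₀
  have hloc : Function.Injective loc := by
    rintro (i | u) (i' | u') hh
    · have := (pow_add_mul_inj hβ i.1.2 i'.1.2 (g i).2 (g i').2 hh).1
      exact congrArg _ (Subtype.ext (Fin.ext this))
    · exact absurd (Fin.ext (pow_add_mul_inj hβ i.1.2 i₀.2 (g i).2 u'.2 hh).1) i.2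
    · exact absurd (Fin.ext (pow_add_mul_inj hβ i₀.2 i'.1.2 u.2 (g i').2 hh).1).symm i'.2
    · exact congrArg _ (Fin.ext (pow_add_mul_inj hβ i₀.2 i₀.2 u.2 u'.2 hh).2)
  have hlocator : ∀ u i, locator β (rowOf i₀ g u) i =
      if h : i = i₀ then loc (Sum.inr u) else loc (Sum.inl ⟨i, h⟩) := by
    intro u i
    by_cases h : i = i₀
    · subst h; simp [locator, rowOf, loc]
    · simp [locator, rowOf, loc, h]
  have hsum : ∀ t < r, ∑ s, loc s ^ t * x s = 0 := by
    intro t ht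
    have hrow : ∀ u, loc (Sum.inr u) ^ t * c (rowOf i₀ g u) i₀ +
        ∑ i : {i // i ≠ i₀}, loc (Sum.inl i) ^ t * c (rowOf i₀ g u) i = 0 := by
      intro u
      have h1 := mem_ker_localParity.1 (hc (rowOf i₀ g u)) t ht
      rw [← Finset.add_sum_erase _ _ (Finset.mem_univ i₀), hlocator, dif_pos rfl] at h1
      rw [← h1]
      congr 1
      rw [Finset.sum_subtype (p := fun i => i ≠ i₀) (Finset.univ.erase i₀) (by simp)]
      refine Finset.sum_congr rfl fun i _ => ?_
      rw [hlocator, dif_neg i.2]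
    have h2 := Finset.sum_eq_zero fun u (_ : u ∈ Finset.univ) => hrow u
    rw [Finset.sum_add_distrib, Finset.sum_comm] at h2
    rw [Fintype.sum_sum_type, add_comm, ← h2]
    simp [x, Finset.mul_sum]
  let S : Finset {i // i ≠ i₀} := R.subtype fun i => i ≠ i₀
  have hS : S.card = d := by
    rw [Finset.card_subtype, Finset.filter_true_of_mem, hR]
    rintro i hiR rfl
    exact hi hiR
  -- The unknown places are the `n - 1 - d` nodes that do not help and the `b` places of the failed
  -- node, by `hdim` exactly `r` in all.
  have hx := eq_zero_of_sum_pow_mul_eq_zero loc x hloc hsum (Sᶜ.disjSum Finset.univ) (by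
      have : Fintype.card {i // i ≠ i₀} = n - 1 := by simp
      rw [Finset.card_disjSum, Finset.card_compl, hS, this, Finset.card_univ, Fintype.card_fin]
      have := i₀.2
      have := Finset.card_le_univ S
      omega) (by
      rintro (i | u) hs
      · simp only [Finset.inl_mem_disjSum, Finset.mem_compl, not_not, S, Finset.mem_subtype] at hs
        exact h i hs g
      · simp at hs)
  exact congrFun hx (Sum.inr u₀)

/-- Each helper sends one sum for every choice of the `n - 1` digits other than that of the failed
node. -/
theorem canRepair_localCode {β : F} {n b r d : ℕ} (hβ : b * n ≤ orderOf β)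
    (hdim : d + r + 1 = n + b) {i₀ : Fin n} {R : Finset (Fin n)} (hi : i₀ ∉ R) (hR : R.card = d) :
    CanRepair (localCode β n b r) {i₀} R (d * b ^ (n - 1)) := by
  classical
  have hcard : Fintype.card ({i // i ≠ i₀} → Fin b) = b ^ (n - 1) := by simp
  let e : Fin (b ^ (n - 1)) ≃ ({i // i ≠ i₀} → Fin b) := (Fintype.equivFinOfCardEq hcard).symm
  let f : (Fin (b ^ n) → F) →ₗ[F] (Fin (b ^ (n - 1)) → F) :=
    { toFun := fun y s => ∑ u, y (rowOf i₀ (e s) u)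
      map_add' := fun y z => funext fun s => Finset.sum_add_distrib
      map_smul' := fun t y => funext fun s => by simp [Finset.mul_sum] }
  rw [← hR]
  refine canRepair_of_linear {i₀} R _ f fun c hc h j hj a => ?_
  obtain rfl := Finset.mem_singleton.1 hj
  refine localCode_eq_zero_of_sum_eq_zero hβ hdim hc hi hR (fun i hiR g => ?_) a
  simpa [f] using congrFun (h i hiR) (e.symm g)

theorem repairBandwidth_localCode [Fintype F] {β : F} {n b r d : ℕ} (hβ : b * n ≤ orderOf β)
    (hb : 0 < b) (hr : r < n) (hdim : d + r + 1 = n + b) {i₀ : Fin n} {R : Finset (Fin n)}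
    (hi : i₀ ∉ R) (hR : R.card = d) :
    repairBandwidth (localCode β n b r) {i₀} R = (d * b ^ (n - 1) : ℕ) := by
  refine le_antisymm (sInf_le ⟨_, rfl, canRepair_localCode hβ hdim hi hR⟩) (le_sInf ?_)
  rintro _ ⟨m, rfl, hm⟩
  have h := hm.cutSet (b := b) (localCode_exists_eq_on hβ hr.le) hi (by omega) (by omega)
  rw [hR, ← Nat.sub_add_cancel (Nat.one_le_of_lt hr), pow_succ, ← mul_assoc, mul_comm] at h
  exact_mod_cast Nat.le_of_mul_le_mul_left h hb

theorem isMSR_localCode [Fintype F] {β : F} {n b r d : ℕ} (hβ : b * n ≤ orderOf β) (hb : 0 < b)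
    (hr0 : 0 < r) (hr : r < n) (hdn : d < n) (hdim : d + r + 1 = n + b) :
    IsMSR (localCode β n b r) r 1 d := by
  classical
  refine ⟨by simpa using isMDS_localCode hβ hb hr, hr0, by rw [Fintype.card_fin]; omega,
    d * b ^ (n - 1), ⟨?_, ?_⟩, ?_⟩
  · have i₀ : Fin n := ⟨0, by omega⟩
    obtain ⟨R, hRs, hR⟩ := Finset.exists_subset_card_eq
      (s := Finset.univ.erase i₀) (n := d)
      (by rw [Finset.card_erase_of_mem (Finset.mem_univ _), Finset.card_univ, Fintype.card_fin]
          omega)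
    have hi : i₀ ∉ R := fun h => by simpa using hRs h
    exact ⟨{i₀}, R, by simp, hR, by simpa using hi,
      (repairBandwidth_localCode hβ hb hr hdim hi hR).symm⟩
  · rintro _ ⟨A, R, hA, hR, hd, rfl⟩
    obtain ⟨i₀, rfl⟩ := Finset.card_eq_one.1 hA
    exact (repairBandwidth_localCode hβ hb hr hdim (by simpa using hd) hR).le
  · have h1 : (d : ℚ) + r + 1 = n + b := by exact_mod_cast hdim
    have h2 : (1 : ℚ) + d - n + r = b := by linarith
    have h3 : (b : ℚ) ≠ 0 := by exact_mod_cast hb.ne'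
    have h4 : (b : ℚ) ^ n = b ^ (n - 1) * b := by
      rw [← pow_succ, Nat.sub_add_cancel (Nat.one_le_of_lt hr)]
    rw [Fintype.card_fin]
    push_cast
    rw [h2, h4]
    field_simp

end Code

/-! ### The global code: dimension, punctured codes and restriction to groups. -/

section Global

variable {F : Type*} [Field F] {n b μ r N : ℕ}

theorem mem_ker_parityCheck {β : F} {a : Fin (b ^ n)} {x : Fin μ × Fin n → F} :
    x ∈ LinearMap.ker (parityCheck β μ r N a).mulVecLin ↔
      (∀ j, (fun i => x (j, i)) ∈ LinearMap.ker (localParity β r a).mulVecLin) ∧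
      ∑ j, ∑ i, locator β a i ^ r * x (j, i) = 0 ∧
      ∑ j : Fin μ, ∑ i, (β ^ ((j : ℕ) * N))⁻¹ * (locator β a i)⁻¹ * x (j, i) = 0 := by
  simp only [mem_ker_localParity]
  rw [LinearMap.mem_ker, Matrix.mulVecLin_apply, funext_iff, Sum.forall, Fin.forall_fin_two,
    Prod.forall]
  refine and_congr (forall_congr' fun j => ?_) (and_congr ?_ ?_)
  · rw [Fin.forall_iff]
    refine forall₂_congr fun t ht => ?_
    rw [Matrix.mulVec, dotProduct, Fintype.sum_prod_type]
    change ∑ k, ∑ i, (if j = k then locator β a i ^ t else 0) * x (k, i) = 0 ↔ _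
    rw [Finset.sum_eq_single j (fun k _ hk => by simp [hk.symm]) (by simp)]
    simp
  · rw [Matrix.mulVec, dotProduct, Fintype.sum_prod_type]
    rfl
  · rw [Matrix.mulVec, dotProduct, Fintype.sum_prod_type]
    rfl

theorem sdCode_eq_rowCode (β : F) (μ n r N d : ℕ) :
    sdCode β μ n r N d = rowCode fun a => LinearMap.ker (parityCheck β μ r N a).mulVecLin := rfl

/-- Keep the nodes outside the positions `E` of all groups. -/
def outside (μ : ℕ) {n : ℕ} (E : Finset (Fin n)) (p : Fin μ × {i : Fin n // i ∉ E}) :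
    Fin μ × Fin n := (p.1, p.2.1)

theorem card_outside (μ : ℕ) {n r : ℕ} {E : Finset (Fin n)} (hE : E.card = r) :
    Fintype.card (Fin μ × {i : Fin n // i ∉ E}) = (n - r) * μ := by
  rw [Fintype.card_prod, Fintype.card_subtype_compl, Fintype.card_fin, Fintype.card_fin,
    Fintype.card_coe, hE, mul_comm]

theorem eq_zero_of_mem_ker_parityCheck {β : F} (hβ : b * n ≤ orderOf β) (hN : b * n ≤ N)
    (hNμ : N * μ ≤ orderOf β) (hβ0 : β ≠ 0) {a : Fin (b ^ n)} {x : Fin μ × Fin n → F}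
    (hx : x ∈ LinearMap.ker (parityCheck β μ r N a).mulVecLin) {E : Finset (Fin n)}
    (hE : E.card = r) (p p' : Fin μ × Fin n) (h : ∀ s, s.2 ∉ E → s ≠ p → s ≠ p' → x s = 0) :
    x = 0 := by
  obtain ⟨hl, hA, hB⟩ := mem_ker_parityCheck.1 hx
  refine eq_zero_of_moments (locator β a) (locator_injective hβ a) (fun i => pow_ne_zero _ hβ0)
    (fun j => β ^ ((j : ℕ) * N)) (fun j => pow_ne_zero _ hβ0) ?_ E x
    (fun j => hE ▸ mem_ker_localParity.1 (hl j)) (hE ▸ hA) hB p p' h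
  intro j j' i i' hj heq
  simp only [locator, ← pow_add] at heq
  have hlt : ∀ i : Fin n, (i : ℕ) + (finFunctionFinEquiv.symm a i : ℕ) * n < N := fun i => by
    have h1 : ((finFunctionFinEquiv.symm a i : ℕ) + 1) * n ≤ b * n :=
      Nat.mul_le_mul_right n (Fin.is_lt _)
    rw [add_mul, one_mul] at h1
    have := i.2
    omega
  -- The locator exponents are below `b * n ≤ N`, so `j` is the leading digit in base `N`.
  have := (pow_add_mul_inj (by rwa [mul_comm]) (hlt i) (hlt i') j.2 j'.2
    (by rwa [add_comm _ ((j : ℕ) * N), add_comm _ ((j' : ℕ) * N)])).2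
  exact hj (Fin.ext this)

variable {β : F} (hβ : b * n ≤ orderOf β) (hN : b * n ≤ N) (hNμ : N * μ ≤ orderOf β) (hβ0 : β ≠ 0)
  (hs : 2 ≤ (n - r) * μ) {E : Finset (Fin n)} (hE : E.card = r)

include hβ hN hNμ hβ0 hs hE

theorem eq_zero_of_eq_zero_on_outside {a : Fin (b ^ n)} {x : Fin μ × Fin n → F}
    (hx : x ∈ LinearMap.ker (parityCheck β μ r N a).mulVecLin)
    (U : Finset (Fin μ × {i : Fin n // i ∉ E})) (hU : U.card = (n - r) * μ - 2)
    (h : ∀ s ∈ U, x (outside μ E s) = 0) : x = 0 := by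
  classical
  have hc : Uᶜ.card = 2 := by rw [Finset.card_compl, hU, card_outside μ hE]; omega
  obtain ⟨p, p', -, hp⟩ := Finset.card_eq_two.1 hc
  refine eq_zero_of_mem_ker_parityCheck hβ hN hNμ hβ0 hx hE (outside μ E p) (outside μ E p')
    fun s hsE h1 h2 => ?_
  refine h (s.1, ⟨s.2, hsE⟩) ?_
  by_contra hsU
  rw [← Finset.mem_compl, hp, Finset.mem_insert, Finset.mem_singleton] at hsU
  rcases hsU with e | e
  · exact h1 (e ▸ rfl)
  · exact h2 (e ▸ rfl)

theorem separated_map_outside (a : Fin (b ^ n)) :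
    Separated ((LinearMap.ker (parityCheck β μ r N a).mulVecLin).map
      (LinearMap.funLeft F F (outside μ E))) ((n - r) * μ - 2) := by
  rintro U hU _ ⟨x, hx, rfl⟩ h
  rw [eq_zero_of_eq_zero_on_outside hβ hN hNμ hβ0 hs hE hx U hU h, map_zero]

/-- Puncturing `E` in all groups loses nothing, since these erasures are correctable. -/
theorem finrank_map_outside (a : Fin (b ^ n)) :
    Module.finrank F ((LinearMap.ker (parityCheck β μ r N a).mulVecLin).map
      (LinearMap.funLeft F F (outside μ E))) =
      Module.finrank F (LinearMap.ker (parityCheck β μ r N a).mulVecLin) := by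
  obtain ⟨U, -, hU⟩ := Finset.exists_subset_card_eq
    (s := (Finset.univ : Finset (Fin μ × {i : Fin n // i ∉ E}))) (n := (n - r) * μ - 2)
    (by rw [Finset.card_univ, card_outside μ hE]; omega)
  rw [← LinearMap.range_domRestrict]
  refine LinearMap.finrank_range_of_inj ?_
  rw [← LinearMap.ker_eq_bot, LinearMap.ker_eq_bot']
  intro x hx
  exact Subtype.ext (eq_zero_of_eq_zero_on_outside hβ hN hNμ hβ0 hs hE x.2 U hU
    fun s _ => congrFun hx s)

/-- Counting the `r * μ + 2` checks bounds the dimension below; separation of the punctured code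
bounds it above. -/
theorem finrank_ker_parityCheck (a : Fin (b ^ n)) :
    Module.finrank F (LinearMap.ker (parityCheck β μ r N a).mulVecLin) = (n - r) * μ - 2 := by
  refine le_antisymm ?_ ?_
  · rw [← finrank_map_outside hβ hN hNμ hβ0 hs hE a]
    exact (separated_map_outside hβ hN hNμ hβ0 hs hE a).finrank_le
      (by rw [card_outside μ hE]; omega)
  · have := finrank_ker_mulVecLin_ge (parityCheck β μ r N a)
    simp only [Fintype.card_prod, Fintype.card_fin, Fintype.card_sum] at this
    rw [mul_comm (n - r), Nat.mul_sub]
    omega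

/-- The global checks must not constrain a single group. By `hs'`, the `n - r` nodes of group `j`
outside `E` fit into an information set of the punctured code, so their contents can be prescribed;
the local checks determine the rest of the group. -/
theorem map_group_ker_parityCheck (hr : r ≤ n) (hs' : 2 ≤ (n - r) * (μ - 1)) (j : Fin μ)
    (a : Fin (b ^ n)) :
    (LinearMap.ker (parityCheck β μ r N a).mulVecLin).map
      (LinearMap.funLeft F F fun i => (j, i)) = LinearMap.ker (localParity β r a).mulVecLin := by
  classical
  refine le_antisymm ?_ fun x hx => ?_
  · rintro _ ⟨x, hx, rfl⟩
    exact (mem_ker_parityCheck.1 hx).1 j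
  have hcardE : (Finset.univ : Finset {i : Fin n // i ∉ E}).card = n - r := by
    rw [Finset.card_univ, Fintype.card_subtype_compl, Fintype.card_fin, Fintype.card_coe, hE]
  have hμ : (n - r) * μ = (n - r) * (μ - 1) + (n - r) := by
    conv_lhs => rw [← Nat.sub_add_cancel (Nat.one_le_of_lt j.2), mul_add, mul_one]
  obtain ⟨U, hjU, -, hU⟩ := Finset.exists_subsuperset_card_eq (n := (n - r) * μ - 2)
    (Finset.subset_univ ({j} ×ˢ (Finset.univ : Finset {i : Fin n // i ∉ E})))
    (by rw [Finset.card_product, hcardE, Finset.card_singleton]; omega)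
    (by rw [Finset.card_univ, card_outside μ hE]; omega)
  obtain ⟨_, ⟨z, hz, rfl⟩, hzx⟩ :=
    (separated_map_outside hβ hN hNμ hβ0 hs hE a).exists_eq_on
      ((finrank_map_outside hβ hN hNμ hβ0 hs hE a).trans
        (finrank_ker_parityCheck hβ hN hNμ hβ0 hs hE a)) U hU fun s => x s.2
  refine ⟨z, hz, ?_⟩
  rw [← sub_eq_zero]
  refine separated_ker_localParity hβ hr a Eᶜ
    (by rw [Finset.card_compl, hE, Fintype.card_fin]) _
    (Submodule.sub_mem _ ((mem_ker_parityCheck.1 hz).1 j) hx) fun i hi => ?_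
  have := hzx (j, ⟨i, Finset.mem_compl.1 hi⟩) (hjU (by simp))
  exact sub_eq_zero.2 this

end Global

/-! ### Existence of `β` and assembly of the theorem. -/

section Main

variable {F : Type*} [Field F]

theorem exists_orderOf_ge [Fintype F] {m : ℕ} (h : m < Fintype.card F) :
    ∃ β : F, m ≤ orderOf β := by
  classical
  obtain ⟨g, hg⟩ := IsCyclic.exists_generator (α := Fˣ)
  refine ⟨g, ?_⟩
  rw [orderOf_units, orderOf_eq_card_of_forall_mem_zpowers hg, Nat.card_eq_fintype_card,
    Fintype.card_units]
  omega

theorem isLocallyMSRSD_sdCode [Fintype F] {μ n r d : ℕ} (hμ : 0 < μ) (hr : 0 < r) (hrn : r ≤ n)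
    (hs : 2 ≤ (n - r) * (μ - 1)) (hd : n - r ≤ d) (hdn : d < n) {β : F}
    (h1 : r * n * μ ≤ orderOf β) (h2 : base n r d * n ≤ orderOf β) :
    IsLocallyMSRSD (sdCode β μ n r (r * n) d) μ n r 2 1 d := by
  have hlt : r < n := by
    by_contra h
    rw [Nat.sub_eq_zero_of_le (not_lt.1 h), zero_mul] at hs
    omega
  have hb : 0 < base n r d := by simp only [base]; omega
  have hdim : d + r + 1 = n + base n r d := by simp only [base]; omega
  -- Since `d < n`, the base `b` is at most `r`; hence `N = r * n` exceeds every exponent of a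
  -- locator.
  have hN : base n r d * n ≤ r * n := Nat.mul_le_mul_right n (by simp only [base]; omega)
  have hβ0 : β ≠ 0 := by
    -- The order of `0` is `0` by convention, against the positive lower bound `h1`.
    rintro rfl
    have : 0 < r * n * μ := Nat.mul_pos (Nat.mul_pos hr (by omega)) hμ
    simp at h1
    omega
  have hμ1 : (n - r) * μ = (n - r) * (μ - 1) + (n - r) := by
    conv_lhs => rw [← Nat.sub_add_cancel (Nat.one_le_of_lt hμ), mul_add, mul_one]
  have hs2 : 2 ≤ (n - r) * μ := by omega
  -- The dimension and the restrictions to groups do not involve `E`, but their proofs need some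
  -- erasure set of size `r`.
  obtain ⟨E₀, -, hE₀⟩ := Finset.exists_subset_card_eq (s := (Finset.univ : Finset (Fin n)))
    (n := r) (by simpa using hrn)
  have hgroup : ∀ j : Fin μ, restrict (sdCode β μ n r (r * n) d) (fun i : Fin n => (j, i)) =
      localCode β n (base n r d) r := fun j => by
    rw [sdCode_eq_rowCode, restrict_rowCode, localCode]
    congr 1
    funext a
    exact map_group_ker_parityCheck h2 hN h1 hβ0 hs2 hE₀ hrn hs j a
  refine ⟨Equiv.refl _, ⟨⟨hμ, by omega, hr, two_pos, pow_pos hb n⟩, hrn, hs2, ?_, fun j => ?_,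
    fun E hE => ?_⟩, fun j => ?_⟩
  · rw [HasDim, sdCode_eq_rowCode, finrank_rowCode]
    simp [finrank_ker_parityCheck h2 hN h1 hβ0 hs2 hE₀, mul_comm]
  · exact (hgroup j).symm ▸ isMDS_localCode h2 hb hlt
  · rw [sdCode_eq_rowCode, restrict_rowCode]
    refine isMDS_rowCode _ (pow_pos hb n) (by omega) (fun a => ?_)
      (separated_map_outside h2 hN h1 hβ0 hs2 hE) (by rw [card_outside μ hE]; omega)
    exact (finrank_map_outside h2 hN h1 hβ0 hs2 hE a).trans
      (finrank_ker_parityCheck h2 hN h1 hβ0 hs2 hE a)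
  · exact (hgroup j).symm ▸ isMSR_localCode h2 hb hr hlt hdn hdim

end Main
end ArrayCode

theorem mainTheorem2 {F : Type*} [Field F] [Fintype F] (q w μ n r d : ℕ)
    (hcard : Fintype.card F = q) (hq2 : q = 2 ^ w)
    (hμ : 0 < μ) (hr : 0 < r) (hrn : r ≤ n)
    (hs : 2 ≤ (n - r) * (μ - 1))
    (hd : n - r ≤ d) (hdn : d < n)
    (hq : max (r * n * μ) (ArrayCode.base n r d * n) ≤ q) :
    (max (r * n * μ) (ArrayCode.base n r d * n) < q →
      ∃ β : F, max (r * n * μ) (ArrayCode.base n r d * n) ≤ orderOf β) ∧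
    ∀ β : F, max (r * n * μ) (ArrayCode.base n r d * n) ≤ orderOf β →
      ArrayCode.IsLocallyMSRSD (ArrayCode.sdCode β μ n r (r * n) d) μ n r 2 1 d :=
  ⟨fun h => ArrayCode.exists_orderOf_ge (hcard ▸ h), fun _ hβ =>
    ArrayCode.isLocallyMSRSD_sdCode hμ hr hrn hs hd hdn ((le_max_left _ _).trans hβ)
      ((le_max_right _ _).trans hβ)⟩
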